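/- Let $K\in\mathbb N$, write $[K]=\{1,\dots,K\}$ and $Z_{[K]}=\prod_{i\in[K]}Z_i$, and let $\mathcal Q_i,\mathcal A_i,\mathcal Y_i$ ($i\in[K]$) be finite sets. All logarithms and entropies are to base $2$. **Cooperation.** A conditional probability $P(a_{[K]}\mid q_{[K]})$ from finite sets $\mathcal Q_{[K]}$ to $\mathcal A_{[K]}$ is (C) *classical* if $P(a_{[K]}|q_{[K]})=\sum_{v}P_V(v)\prod_{i}P_i(a_i|q_i,v)$ for a probability distribution $P_V$ on a finite set and conditional probabilities $P_i$; (Q) *quantum* if $P(a_{[K]}|q_{[K]})=\mathrm{Tr}\big((\bigotimes_i\Pi^i_{a_i|q_i})\rho\big)$ for a density operator $\rho$ on a tensor product $\bigotimes_i \mathcal H_i$ of finite-dimensional complex Hilbert spaces and POVMs $\{\Pi^i_{a_i|q_i}\}_{a_i\in\mathcal A_i}$ on $\mathcal H_i$; (NS) *no-signaling* if for each $i$ the marginal distribution of $a_i$ given $q_{[K]}$ depends only on $q_i$. Let $\mathcal E^r$, $r\in\{\mathrm C,\mathrm Q,\mathrm{NS}\}$, be the set of cooperations of type $r$. **Games.**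 A game $G=(\mathcal Q_{[K]},\mathcal A_{[K]},\mathcal W)$ has winning condition $\mathcal W\subseteq\mathcal Q_{[K]}\times\mathcal A_{[K]}$, and $p_w^r(G)=\max_{P\in\mathcal E^r}\sum_{(q,a)\in\mathcal W}P(a|q)/|\mathcal Q_{[K]}|$. For $r\in\{\mathrm Q,\mathrm{NS}\}$, $G$ is an *$r$-pseudo-telepathy game* if $p_w^r(G)=1$ (the maximum being attained) and $p_w^{\mathrm C}(G)<1$. **Game channels.** A conditional probability $V(y|q)$ between finite sets is *weakly symmetric* if $\sum_qV(y|q)$ does not depend on $y$ and the rows $V(\cdot|q)$ are permutations of one another. A *$G$-game channel* is a memoryless interference channel $P(y_{[K]}|x_{[K]})$ with input alphabets $\mathcal X_i=\mathcal Q_i\times\mathcal A_i$ and output alphabets $\mathcal Y_i$, such that (1) $H(Y_{[K]}|X_{[K]}=x)<H(Y_{[K]}|X_{[K]}=\tilde x)$ for all $x\in\mathcal W$, $\tilde x\notin\mathcal W$, and (2) there are weakly symmetric channels $P_{Y_i|Q_i}$ with $P(y_{[K]}|q_{[K]},a_{[K]})=\prod_iP_{Y_i|Q_i}(y_i|q_i)$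 for all $(q_{[K]},a_{[K]})\in\mathcal W$. **Sum capacity.** For rates $R_i\ge0$, an $(n,R_{[K]},r)$-code consists of message sets $\mathcal M_i$ of size $2^{\lceil nR_i\rceil}$, a cooperative encoder $P_{X^n_{[K]}|M_{[K]}}\in\mathcal E^r$ (party $i$ receives $M_i$ and outputs $X_i^n\in\mathcal X_i^n$), and decoders $g_i:\mathcal Y_i^n\to\mathcal M_i\cup\{e\}$. The tuple $R_{[K]}$ is $r$-achievable if there is a sequence of such codes, one for each $n$, for which, with independent uniform messages and $n$ memoryless uses of the channel, $\Pr(\hat M_{[K]}\ne M_{[K]})\to0$. The $r$-capacity region is the closure of the set of $r$-achievable tuples, and the $r$-sum capacity $\mathcal C_s^r$ is the maximum of $\sum_iR_i$ over this region. **Proposition.** Let $r\in\{\mathrm Q,\mathrm{NS}\}$, let $G$ be an $r$-pseudo-telepathy game and let $P$ be a $G$-game channel with sub-channels $P_{Y_i|Q_i}$. Then for each $i$ the entropy $h_i^w:=H(Y_i|Q_i=q)$ of $P_{Y_i|Q_i}(\cdot|q)$ is the same for all $q\in\mathcal Q_i$, the maximum defining $\mathcal C_s^r(P)$ exists, and $$\mathcal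 C_s^r(P)=\sum_{i\in[K]}\big(\log|\mathcal Y_i|-h_i^w\big).$$ -/

import Mathlib

noncomputable section

namespace GameIC

/-- `P q a` is the conditional probability of `a` given `q`. -/
def IsCondProb {α β : Type*} [Fintype β] (P : α → β → ℝ) : Prop :=
  (∀ x y, 0 ≤ P x y) ∧ ∀ x, ∑ y, P x y = 1

/-- Shannon entropy in bits of a probability vector on a finite set. -/
def entropy {β : Type*} [Fintype β] (p : β → ℝ) : ℝ :=
  -∑ y, p y * Real.logb 2 (p y)

section Cooperation

variable {K : ℕ} {Q A : Fin K → Type*} [∀ i, Fintype (A i)]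

/-- Classical cooperation: shared randomness `v` from a finite set together with local
randomized responses. -/
def IsClassical (P : (∀ i, Q i) → (∀ i, A i) → ℝ) : Prop :=
  ∃ (S : Type) (_ : Fintype S) (pV : S → ℝ) (D : ∀ i, Q i × S → A i → ℝ),
    (∀ v, 0 ≤ pV v) ∧ ∑ v, pV v = 1 ∧ (∀ i, IsCondProb (D i)) ∧
    ∀ q a, P q a = ∑ v, pV v * ∏ i, D i (q i, v) (a i)

/-- The tensor product `⊗ᵢ Mᵢ` of square matrices, as a matrix whose rows and columns are
indexed by tuples of basis labels. -/
def tensorMatrix {H : Fin K → Type*} (M : ∀ i, Matrix (H i) (H i) ℂ) :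
    Matrix (∀ i, H i) (∀ i, H i) ℂ :=
  Matrix.of fun s t => ∏ i, M i (s i) (t i)

open scoped ComplexOrder in
/-- A quantum state on a finite-dimensional space: a density matrix. -/
def IsDensityMatrix {ι : Type*} [Fintype ι] (ρ : Matrix ι ι ℂ) : Prop :=
  ρ.PosSemidef ∧ ρ.trace = 1

open scoped ComplexOrder in
/-- A measurement (positive operator-valued measure) with finite outcome set `β`. -/
def IsPOVM {ι β : Type*} [Fintype ι] [DecidableEq ι] [Fintype β]
    (E : β → Matrix ι ι ℂ) : Prop :=
  (∀ b, (E b).PosSemidef) ∧ ∑ b, E b = 1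

/-- Quantum cooperation: party `i` holds a finite-dimensional system, with orthonormal basis
labelled by `H i`, of a shared state `ρ`, and on question `q i` performs on its system the
measurement `E i (q i)`. -/
def IsQuantum (P : (∀ i, Q i) → (∀ i, A i) → ℝ) : Prop :=
  ∃ (H : Fin K → Type) (_ : ∀ i, Fintype (H i)) (_ : ∀ i, DecidableEq (H i))
    (ρ : Matrix (∀ i, H i) (∀ i, H i) ℂ) (E : ∀ i, Q i → A i → Matrix (H i) (H i) ℂ),
    IsDensityMatrix ρ ∧ (∀ i q, IsPOVM (E i q)) ∧
    ∀ q a, (P q a : ℂ) = (tensorMatrix (fun i => E i (q i) (a i)) * ρ).trace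

open Classical in
/-- The probability that the answer of party `i` is `b` when the question tuple is `q`. -/
def marginal (P : (∀ i, Q i) → (∀ i, A i) → ℝ) (i : Fin K) (q : ∀ i, Q i) (b : A i) : ℝ :=
  ∑ a : ∀ i, A i, if a i = b then P q a else 0

/-- No-signaling cooperation: the law of the answer of each party depends on the question tuple
only through the question of that party. -/
def IsNoSignaling (P : (∀ i, Q i) → (∀ i, A i) → ℝ) : Prop :=
  ∀ (i : Fin K) (q q' : ∀ i, Q i), q i = q' i → ∀ b, marginal P i q b = marginal P i q' b

end Cooperation

/-- The three types of cooperation. -/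
inductive CoopType
  | classical
  | quantum
  | noSignaling

/-- The set of all cooperations of type `r` from question sets `Q i` to answer sets `A i`. -/
def cooperations (r : CoopType) {K : ℕ} (Q A : Fin K → Type*) [∀ i, Fintype (A i)] :
    Set ((∀ i, Q i) → (∀ i, A i) → ℝ) :=
  {P | IsCondProb P ∧
    match r with
    | .classical => IsClassical P
    | .quantum => IsQuantum P
    | .noSignaling => IsNoSignaling P}

/-- A promise-free `K`-party game with question sets `Q i` and answer sets `A i`. -/
structure Game {K : ℕ} (Q A : Fin K → Type*) where
  /-- the winning condition -/
  win : Set ((∀ i, Q i) × (∀ i, A i))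

section Games

variable {K : ℕ} {Q A Y : Fin K → Type*} [∀ i, Fintype (Q i)] [∀ i, Fintype (A i)]
  [∀ i, Fintype (Y i)]

open Classical in
/-- Probability of winning with strategy `P` when the questions are uniform. -/
def winProb (G : Game Q A) (P : (∀ i, Q i) → (∀ i, A i) → ℝ) : ℝ :=
  ∑ q, ∑ a, if (q, a) ∈ G.win then P q a / Fintype.card (∀ i, Q i) else 0

/-- `p` is the maximum winning probability of `G` over cooperations of type `r`. -/
def IsMaxWinProb (G : Game Q A) (r : CoopType) (p : ℝ) : Prop :=
  IsGreatest (winProb G '' cooperations r Q A) p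

/-- `G` is an `r`-pseudo-telepathy game (for `r = classical` this never holds). -/
def IsPseudoTelepathy (r : CoopType) (G : Game Q A) : Prop :=
  IsMaxWinProb G r 1 ∧ ∃ p < 1, IsMaxWinProb G .classical p

/-- Weak symmetry of a point-to-point channel: constant column sums, and rows that are
permutations of each other. -/
def IsWeaklySymmetric {α β : Type*} [Fintype α] (V : α → β → ℝ) : Prop :=
  (∃ c, ∀ y, ∑ q, V q y = c) ∧
    ∀ q q', ∃ σ : Equiv.Perm β, ∀ y, V q' y = V q (σ y)

/-- The question tuple and the answer tuple of a tuple of question-answer pairs. -/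
def splitInput (x : ∀ i, Q i × A i) : (∀ i, Q i) × (∀ i, A i) :=
  (fun i => (x i).1, fun i => (x i).2)

/-- `P` is a `G`-game channel, and `V i` is the sub-channel from the question of transmitter `i`
to the output of receiver `i` when the winning condition holds. -/
structure IsGameChannel (G : Game Q A) (P : (∀ i, Q i × A i) → (∀ i, Y i) → ℝ)
    (V : ∀ i, Q i → Y i → ℝ) : Prop where
  condProb : IsCondProb P
  condProb_sub : ∀ i, IsCondProb (V i)
  less_noisy : ∀ x x' : ∀ i, Q i × A i, splitInput x ∈ G.win → splitInput x' ∉ G.win →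
    entropy (P x) < entropy (P x')
  parallel : ∀ x : ∀ i, Q i × A i, splitInput x ∈ G.win →
    ∀ y, P x y = ∏ i, V i (x i).1 (y i)
  weaklySymmetric : ∀ i, IsWeaklySymmetric (V i)

end Games

section Coding

/-- Number of messages of a transmitter of rate `R` in block length `n`. -/
def numMsg (n : ℕ) (R : ℝ) : ℕ := 2 ^ ⌈(n : ℝ) * R⌉₊

variable {K : ℕ} (X Y : Fin K → Type*) [∀ i, Fintype (X i)] [∀ i, Fintype (Y i)]

/-- An `(n, R, r)`-code: a cooperative encoder of type `r` taking the message tuple to the tuple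
of codewords, and local decoders, where `none` is the error symbol. -/
structure Code (r : CoopType) (n : ℕ) (R : Fin K → ℝ) where
  enc : (∀ i, Fin (numMsg n (R i))) → (∀ i, Fin n → X i) → ℝ
  enc_mem : enc ∈ cooperations r (fun i => Fin (numMsg n (R i))) (fun i => Fin n → X i)
  dec : ∀ i, (Fin n → Y i) → Option (Fin (numMsg n (R i)))

variable {X Y}

/-- `n` memoryless uses of the channel `P`. -/
def channelPow (P : (∀ i, X i) → (∀ i, Y i) → ℝ) (n : ℕ)
    (x : ∀ i, Fin n → X i) (y : ∀ i, Fin n → Y i) : ℝ :=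
  ∏ j, P (fun i => x i j) (fun i => y i j)

open Classical in
/-- Average error probability of a code: the messages are independent and uniform, and an error
occurs when some receiver does not recover the message of its transmitter. -/
def Code.errorProb {r : CoopType} {n : ℕ} {R : Fin K → ℝ} (c : Code X Y r n R)
    (P : (∀ i, X i) → (∀ i, Y i) → ℝ) : ℝ :=
  ∑ m : ∀ i, Fin (numMsg n (R i)), (∏ i, (numMsg n (R i) : ℝ))⁻¹ *
    ∑ x, c.enc m x * ∑ y, channelPow P n x y *
      (if ∃ i, c.dec i (y i) ≠ some (m i) then 1 else 0)

/-- The rate tuple `R` is `r`-achievable for the interference channel `P`. -/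
def IsAchievable (r : CoopType) (P : (∀ i, X i) → (∀ i, Y i) → ℝ) (R : Fin K → ℝ) : Prop :=
  (∀ i, 0 ≤ R i) ∧ ∃ c : ∀ n : ℕ, Code X Y r n R,
    Filter.Tendsto (fun n => (c n).errorProb P) Filter.atTop (nhds 0)

/-- The `r`-capacity region. -/
def capacityRegion (r : CoopType) (P : (∀ i, X i) → (∀ i, Y i) → ℝ) : Set (Fin K → ℝ) :=
  closure {R | IsAchievable r P R}

/-- `C` is the `r`-sum capacity: the maximum of the sum rate over the `r`-capacity region. -/
def IsSumCapacity (r : CoopType) (P : (∀ i, X i) → (∀ i, Y i) → ℝ) (C : ℝ) : Prop :=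
  IsGreatest ((fun R : Fin K → ℝ => ∑ i, R i) '' capacityRegion r P) C

end Coding

end GameIC

end

/-!
The sum capacity of a game channel equals the sum of the capacities `log |Yᵢ| - hᵢ` of the weakly
symmetric sub-channels, for two reasons.

*Achievability.* A perfect strategy never produces a losing question-answer tuple
(`eq_zero_of_winProb_eq_one`), so transmitters who play it in every channel use see the interference
channel as the product of the sub-channels. Playing `n` independent rounds, with the questions read
off a local codebook and the answers put together with them, is again a cooperation of the same type
(`process_channelPow_mem_cooperations`): for quantum strategies by taking tensor powers of the state
and of the measurements, for no-signaling ones because marginals factor over the rounds. It then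
suffices to code for each sub-channel separately (`IsGameChannel.isAchievable`). By weak symmetry,
uniform inputs give uniform outputs and all inputs have the same output entropy, so Feinstein's
greedy construction (`exists_greedy_code`) yields deterministic codes of every rate below
`log |Yᵢ| - hᵢ` with vanishing maximal error (`IsWeaklySymmetric.exists_code`).

*Converse.* Let all transmitters cooperate without restriction, and all receivers as well. Every
input has output entropy at least `H = ∑ hᵢ`: with equality when it wins, and more when it loses. By
Chebyshev's inequality for the self-information (`sum_overlikely_le`), in `n` uses all outputs have
probability at most `2 ^ (-n (H - δ))` outside an event of vanishing probability. A decoder assigns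
each of the `∏ |Yᵢ| ^ n` outputs to at most one message tuple, so the success probability is at most
`o(1) + 2 ^ (-n (H - δ)) ∏ |Yᵢ| ^ n / 2 ^ (n ∑ Rᵢ)` (`Code.one_le_errorProb_add`), which tends to
zero when `∑ Rᵢ` exceeds the claimed capacity by more than `δ` (`IsAchievable.sum_le`).
-/

namespace GameIC

/-! ### Product distributions and entropy -/

theorem IsCondProb.pi {ι : Type*} [Fintype ι] [DecidableEq ι] {α β : ι → Type*}
    [∀ i, Fintype (β i)] {V : ∀ i, α i → β i → ℝ} (hV : ∀ i, IsCondProb (V i)) :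
    IsCondProb fun (x : ∀ i, α i) (y : ∀ i, β i) => ∏ i, V i (x i) (y i) := by
  refine ⟨fun x y => Finset.prod_nonneg fun i _ => (hV i).1 _ _, fun x => ?_⟩
  rw [← Fintype.prod_sum]
  exact Finset.prod_eq_one fun i _ => (hV i).2 _

/-- The `i`-th coordinate of a product distribution has law `p i`. -/
theorem sum_prod_mul_eval {ι : Type*} [Fintype ι] [DecidableEq ι] {β : ι → Type*}
    [∀ i, Fintype (β i)] {p : ∀ i, β i → ℝ} (hp : ∀ i, ∑ b, p i b = 1) (i : ι) (g : β i → ℝ) :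
    ∑ y : ∀ i, β i, (∏ k, p k (y k)) * g (y i) = ∑ b, p i b * g b := by
  have key : ∀ y : ∀ i, β i, (∏ k, p k (y k)) * g (y i)
      = ∏ k, Function.update p i (fun b => p i b * g b) k (y k) := by
    intro y
    rw [← Finset.mul_prod_erase _ _ (Finset.mem_univ i),
      ← Finset.mul_prod_erase _ (fun k => Function.update p i _ k (y k)) (Finset.mem_univ i)]
    have hne : ∏ k ∈ Finset.univ.erase i, Function.update p i (fun b => p i b * g b) k (y k)
        = ∏ k ∈ Finset.univ.erase i, p k (y k) :=
      Finset.prod_congr rfl fun k hk => by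
        rw [Function.update_of_ne (Finset.ne_of_mem_erase hk)]
    rw [hne, Function.update_self]
    ring
  simp_rw [key]
  rw [← Fintype.prod_sum, ← Finset.mul_prod_erase _ _ (Finset.mem_univ i),
    Finset.prod_eq_one fun k hk => by
      rw [Function.update_of_ne (Finset.ne_of_mem_erase hk), hp]]
  simp

/-- Entropy is additive over independent components. -/
theorem entropy_prod {ι : Type*} [Fintype ι] [DecidableEq ι] {β : ι → Type*}
    [∀ i, Fintype (β i)] {p : ∀ i, β i → ℝ} (hp : ∀ i, ∑ b, p i b = 1) :
    entropy (fun y : ∀ i, β i => ∏ i, p i (y i)) = ∑ i, entropy (p i) := by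
  unfold entropy
  have key : ∀ y : ∀ i, β i, (∏ i, p i (y i)) * Real.logb 2 (∏ i, p i (y i))
      = ∑ i, (∏ k, p k (y k)) * Real.logb 2 (p i (y i)) := by
    intro y
    rw [← Finset.mul_sum]
    by_cases h : ∏ i, p i (y i) = 0
    · simp [h]
    · rw [Real.logb_prod _ _ fun i hi => Finset.prod_ne_zero_iff.1 h i hi]
  simp_rw [key]
  rw [Finset.sum_comm, Finset.sum_neg_distrib]
  congr 1
  exact Finset.sum_congr rfl fun i _ => sum_prod_mul_eval hp i fun b => Real.logb 2 (p i b)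

theorem entropy_comp_equiv {β : Type*} [Fintype β] (p : β → ℝ) (σ : Equiv.Perm β) :
    entropy (fun y => p (σ y)) = entropy p := by
  unfold entropy
  rw [Equiv.sum_comp σ fun y => p y * Real.logb 2 (p y)]

theorem entropy_le_logb_card {β : Type*} [Fintype β] [Nonempty β] {p : β → ℝ}
    (h0 : ∀ b, 0 ≤ p b) (h1 : ∑ b, p b = 1) : entropy p ≤ Real.logb 2 (Fintype.card β) := by
  have hN : (0 : ℝ) < Fintype.card β := by exact_mod_cast Fintype.card_pos
  have hl : 0 < Real.log 2 := Real.log_pos one_lt_two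
  -- `log t ≤ t - 1` at `t = 1 / (p b * card β)`
  have key : ∀ b, -(p b * Real.log (p b)) - p b * Real.log (Fintype.card β)
      ≤ (Fintype.card β : ℝ)⁻¹ - p b := by
    intro b
    rcases (h0 b).eq_or_lt with h | h
    · rw [← h]; simp
    · have := Real.log_le_sub_one_of_pos (x := (p b * Fintype.card β)⁻¹) (by positivity)
      rw [Real.log_inv, Real.log_mul h.ne' hN.ne'] at this
      have h2 := mul_le_mul_of_nonneg_left this h.le
      have h3 : p b * ((p b * Fintype.card β)⁻¹ - 1) = (Fintype.card β : ℝ)⁻¹ - p b := by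
        field_simp
      linarith
  have hs := Finset.sum_le_sum fun b (_ : b ∈ Finset.univ) => key b
  rw [Finset.sum_sub_distrib, Finset.sum_sub_distrib, ← Finset.sum_mul, h1, Finset.sum_const,
    Finset.card_univ, nsmul_eq_mul, mul_inv_cancel₀ hN.ne', Finset.sum_neg_distrib] at hs
  unfold entropy
  simp only [Real.logb, ← mul_div_assoc]
  rw [← Finset.sum_div, ← neg_div]
  gcongr
  linarith

/-! ### The weak law of large numbers for the information density -/

/-- The second moment of a sum of independent centred variables is the sum of the second moments. -/
theorem sum_prod_mul_sum_sq {β : Type*} [Fintype β] :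
    ∀ {n : ℕ} {p Z : Fin n → β → ℝ}, (∀ j, ∑ b, p j b = 1) → (∀ j, ∑ b, p j b * Z j b = 0) →
    ∑ y : Fin n → β, (∏ j, p j (y j)) * (∑ j, Z j (y j)) ^ 2 = ∑ j, ∑ b, p j b * Z j b ^ 2
  | 0, _, _, _, _ => by simp
  | n + 1, p, Z, hp, hZ => by
    have ih := sum_prod_mul_sum_sq (p := fun j : Fin n => p j.succ) (Z := fun j => Z j.succ)
      (fun j => hp _) (fun j => hZ _)
    have h1 : ∑ y : Fin n → β, ∏ j, p j.succ (y j) = 1 := by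
      rw [← Fintype.prod_sum]; exact Finset.prod_eq_one fun j _ => hp _
    have h2 : ∑ y : Fin n → β, (∏ j, p j.succ (y j)) * ∑ j, Z j.succ (y j) = 0 := by
      simp_rw [Finset.mul_sum]
      rw [Finset.sum_comm]
      refine Finset.sum_eq_zero fun j _ => ?_
      rw [sum_prod_mul_eval (p := fun j : Fin n => p j.succ) (fun j => hp _) j (Z j.succ), hZ]
    rw [← (Fin.consEquiv fun _ => β).sum_comp, Fintype.sum_prod_type]
    simp only [Fin.consEquiv, Equiv.coe_fn_mk, Fin.prod_univ_succ, Fin.sum_univ_succ,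
      Fin.cons_zero, Fin.cons_succ]
    have key : ∀ b, ∑ y : Fin n → β, (p 0 b * ∏ j, p j.succ (y j))
          * (Z 0 b + ∑ j, Z j.succ (y j)) ^ 2
        = p 0 b * Z 0 b ^ 2 + p 0 b * ∑ j : Fin n, ∑ b, p j.succ b * Z j.succ b ^ 2 := by
      intro b
      rw [← ih]
      calc _ = ∑ y : Fin n → β, ((p 0 b * Z 0 b ^ 2) * (∏ j, p j.succ (y j))
            + (2 * p 0 b * Z 0 b) * ((∏ j, p j.succ (y j)) * ∑ j, Z j.succ (y j))
            + p 0 b * ((∏ j, p j.succ (y j)) * (∑ j, Z j.succ (y j)) ^ 2)) :=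
            Finset.sum_congr rfl fun y _ => by ring
        _ = _ := by
          rw [Finset.sum_add_distrib, Finset.sum_add_distrib, ← Finset.mul_sum, ← Finset.mul_sum,
            ← Finset.mul_sum, h1, h2]
          ring
    simp_rw [key]
    rw [Finset.sum_add_distrib, ← Finset.sum_mul, hp, one_mul]

/-- Chebyshev's inequality for the self-information `-log ∏ⱼ pⱼ(yⱼ)` of independent variables
whose self-informations have second moment at most `B`. -/
theorem sum_atypical_le {β : Type*} [Fintype β] {n : ℕ} {p : Fin n → β → ℝ} {B δ : ℝ}
    (h0 : ∀ j b, 0 ≤ p j b) (h1 : ∀ j, ∑ b, p j b = 1)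
    (hB : ∀ j, ∑ b, p j b * Real.logb 2 (p j b) ^ 2 ≤ B) (hδ : 0 < δ)
    (T : Finset (Fin n → β))
    (hT : ∀ y ∈ T, 0 < ∏ j, p j (y j) →
      n * δ < |-Real.logb 2 (∏ j, p j (y j)) - ∑ j, entropy (p j)|) :
    ∑ y ∈ T, ∏ j, p j (y j)
      ≤ B / (n * δ ^ 2) := by
  rcases Nat.eq_zero_or_pos n with rfl | hn
  · -- for `n = 0` the bound is `B / 0 = 0`, and no outcome deviates
    have : T = ∅ := by
      refine Finset.eq_empty_of_forall_notMem fun y hy => ?_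
      simpa using hT y hy
    simp [this]
  have hn' : (0 : ℝ) < n := by exact_mod_cast hn
  set Z : Fin n → β → ℝ := fun j b => -Real.logb 2 (p j b) - entropy (p j) with hZdef
  have hZ : ∀ j, ∑ b, p j b * Z j b = 0 := by
    intro j
    simp only [hZdef, mul_sub, Finset.sum_sub_distrib, ← Finset.sum_mul, h1, mul_neg,
      Finset.sum_neg_distrib]
    simp [entropy]
  have hZ2 : ∀ j, ∑ b, p j b * Z j b ^ 2 ≤ B := by
    intro j
    refine le_trans ?_ (hB j)
    have : ∑ b, p j b * Z j b ^ 2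
        = ∑ b, p j b * Real.logb 2 (p j b) ^ 2 - entropy (p j) ^ 2 := by
      calc _ = ∑ b, (p j b * Real.logb 2 (p j b) ^ 2
            + 2 * entropy (p j) * (p j b * Real.logb 2 (p j b)) + entropy (p j) ^ 2 * p j b) :=
            Finset.sum_congr rfl fun b _ => by simp only [hZdef]; ring
        _ = _ := by
          rw [Finset.sum_add_distrib, Finset.sum_add_distrib, ← Finset.mul_sum, ← Finset.mul_sum,
            h1]
          have : ∑ b, p j b * Real.logb 2 (p j b) = -entropy (p j) := by simp [entropy]
          rw [this]; ring
    rw [this]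
    linarith [sq_nonneg (entropy (p j))]
  have hprod : ∀ y : Fin n → β, 0 ≤ ∏ j, p j (y j) :=
    fun y => Finset.prod_nonneg fun j _ => h0 _ _
  rw [le_div_iff₀ (by positivity)]
  have hsq : (∑ y ∈ T, ∏ j, p j (y j)) * (n * δ) ^ 2 ≤ n * B := by
    calc (∑ y ∈ T, ∏ j, p j (y j)) * (n * δ) ^ 2
        = ∑ y ∈ T, (∏ j, p j (y j)) * (n * δ) ^ 2 := Finset.sum_mul ..
      _ ≤ ∑ y ∈ T, (∏ j, p j (y j)) * (∑ j, Z j (y j)) ^ 2 := by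
          refine Finset.sum_le_sum fun y hy => ?_
          rcases (hprod y).eq_or_lt with h | h
          · rw [← h]; simp
          · refine mul_le_mul_of_nonneg_left ?_ h.le
            have := hT y hy h
            rw [Real.logb_prod _ _ fun j hj => Finset.prod_ne_zero_iff.1 h.ne' j hj,
              ← Finset.sum_neg_distrib, ← Finset.sum_sub_distrib] at this
            rw [← sq_abs (∑ j, Z j (y j))]
            gcongr
      _ ≤ ∑ y : Fin n → β, (∏ j, p j (y j)) * (∑ j, Z j (y j)) ^ 2 :=
          Finset.sum_le_sum_of_subset_of_nonneg (Finset.subset_univ _) fun y _ _ =>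
            mul_nonneg (hprod y) (sq_nonneg _)
      _ = ∑ j, ∑ b, p j b * Z j b ^ 2 := sum_prod_mul_sum_sq h1 hZ
      _ ≤ ∑ _j : Fin n, B := Finset.sum_le_sum fun j _ => hZ2 j
      _ = n * B := by simp
  refine le_of_mul_le_mul_left ?_ hn'
  linarith

open Classical in
/-- Outcomes much more likely than the entropy suggests are rare. -/
theorem sum_overlikely_le {β : Type*} [Fintype β] {n : ℕ} {p : Fin n → β → ℝ} {B H δ : ℝ}
    (h0 : ∀ j b, 0 ≤ p j b) (h1 : ∀ j, ∑ b, p j b = 1)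
    (hB : ∀ j, ∑ b, p j b * Real.logb 2 (p j b) ^ 2 ≤ B) (hδ : 0 < δ)
    (hH : ∀ j, H ≤ entropy (p j)) :
    ∑ y : Fin n → β with (2 : ℝ) ^ (-(n * (H - δ))) < ∏ j, p j (y j), ∏ j, p j (y j)
      ≤ B / (n * δ ^ 2) := by
  refine sum_atypical_le h0 h1 hB hδ _ fun y hy hpos => ?_
  rw [Finset.mem_filter] at hy
  have h2 := (Real.lt_logb_iff_rpow_lt one_lt_two hpos).2 hy.2
  have h3 : n * H ≤ ∑ j, entropy (p j) := by
    simpa using Finset.card_nsmul_le_sum Finset.univ (fun j => entropy (p j)) H fun j _ => hH j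
  rw [lt_abs]
  right
  linarith

open Classical in
/-- Outcomes much less likely than the entropy suggests are rare. -/
theorem sum_underlikely_le {β : Type*} [Fintype β] {n : ℕ} {p : Fin n → β → ℝ} {B H δ : ℝ}
    (h0 : ∀ j b, 0 ≤ p j b) (h1 : ∀ j, ∑ b, p j b = 1)
    (hB : ∀ j, ∑ b, p j b * Real.logb 2 (p j b) ^ 2 ≤ B) (hδ : 0 < δ)
    (hH : ∀ j, entropy (p j) ≤ H) :
    ∑ y : Fin n → β with ∏ j, p j (y j) < (2 : ℝ) ^ (-(n * (H + δ))), ∏ j, p j (y j)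
      ≤ B / (n * δ ^ 2) := by
  refine sum_atypical_le h0 h1 hB hδ _ fun y hy hpos => ?_
  rw [Finset.mem_filter] at hy
  have h2 := (Real.logb_lt_iff_lt_rpow one_lt_two hpos).2 hy.2
  have h3 : ∑ j, entropy (p j) ≤ n * H := by
    simpa using Finset.sum_le_card_nsmul Finset.univ (fun j => entropy (p j)) H fun j _ => hH j
  rw [lt_abs]
  left
  linarith

/-! ### Channel coding for weakly symmetric channels -/

open Classical in
/-- Feinstein's greedy construction, for a channel that maps the uniform input distribution to the
uniform output distribution. Codewords are added one at a time; the decoding region of a new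
codeword `x` is the set of unclaimed outputs `y` with `W x y ≥ τ`. Regions have at most `τ⁻¹`
elements each, so the average input gives the claimed outputs little probability. -/
theorem exists_greedy_code {α β : Type*} [Fintype α] [Fintype β] [Nonempty α] [Nonempty β]
    {W : α → β → ℝ} (hW : IsCondProb W) {c : ℝ} (hc : ∀ y, ∑ x, W x y = c) {τ ε : ℝ} (hτ : 0 < τ)
    (hε : ∀ x, ∑ y with W x y < τ, W x y ≤ ε) (M : ℕ) :
    ∃ (f : Fin M → α) (g : β → Option (Fin M)), ∀ m,
      ∑ y with g y ≠ some m, W (f m) y ≤ ε + M / (τ * Fintype.card β) := by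
  have hβ : (0 : ℝ) < Fintype.card β := by exact_mod_cast Fintype.card_pos
  have hcard : Fintype.card β * c = (Fintype.card α : ℝ) := by
    have : ∑ y, ∑ x, W x y = ∑ x, ∑ y, W x y := Finset.sum_comm
    simpa [hc, hW.2] using this
  have aux : ∀ k ≤ M, ∃ (f : ℕ → α) (g : β → Option ℕ),
      ((Finset.univ.filter fun y => g y ≠ none).card : ℝ) * τ ≤ k ∧
      (∀ y m, g y = some m → m < k) ∧
      ∀ m < k, ∑ y with g y ≠ some m, W (f m) y ≤ ε + M / (τ * Fintype.card β) := by
    intro k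
    induction k with
    | zero =>
      intro _
      exact ⟨fun _ => Classical.arbitrary α, fun _ => none, by simp, by simp, by simp⟩
    | succ k ih =>
      intro hk
      obtain ⟨f, g, hD, hlt, herr⟩ := ih (by omega)
      set D := Finset.univ.filter fun y => g y ≠ none with hDdef
      obtain ⟨x, -, hx⟩ : ∃ x ∈ (Finset.univ : Finset α),
          ∑ y ∈ D, W x y ≤ D.card / (Fintype.card β : ℝ) := by
        refine Finset.exists_le_of_sum_le Finset.univ_nonempty ?_
        rw [Finset.sum_comm]
        simp only [hc, Finset.sum_const, Finset.card_univ, nsmul_eq_mul]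
        rw [← hcard]
        apply le_of_eq
        field_simp
      have hsmall : (D.card : ℝ) / Fintype.card β ≤ M / (τ * Fintype.card β) := by
        rw [div_le_div_iff₀ hβ (by positivity)]
        have hkM : (k : ℝ) ≤ M := by exact_mod_cast (by omega : k ≤ M)
        have := mul_le_mul_of_nonneg_right (hD.trans hkM) hβ.le
        linarith
      refine ⟨Function.update f k x,
        fun y => if g y ≠ none then g y else if τ ≤ W x y then some k else none, ?_, ?_, ?_⟩
      · have hsub : (Finset.univ.filter fun y =>
            (if g y ≠ none then g y else if τ ≤ W x y then some k else none) ≠ none)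
            ⊆ D ∪ Finset.univ.filter fun y => τ ≤ W x y := by
          intro y
          simp only [hDdef, Finset.mem_filter, Finset.mem_univ, true_and, Finset.mem_union]
          split_ifs <;> simp_all
        have h1 : ((Finset.univ.filter fun y => τ ≤ W x y).card : ℝ) * τ ≤ 1 := by
          rw [← hW.2 x, ← nsmul_eq_mul]
          refine (Finset.card_nsmul_le_sum _ (W x) τ fun y hy => (Finset.mem_filter.1 hy).2).trans ?_
          exact Finset.sum_le_sum_of_subset_of_nonneg (Finset.subset_univ _) fun y _ _ => hW.1 _ _
        have h2 := (Finset.card_le_card hsub).trans (Finset.card_union_le _ _)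
        have h3 : ((Finset.univ.filter fun y =>
            (if g y ≠ none then g y else if τ ≤ W x y then some k else none) ≠ none).card : ℝ)
            ≤ D.card + (Finset.univ.filter fun y => τ ≤ W x y).card := by exact_mod_cast h2
        have h4 := mul_le_mul_of_nonneg_right h3 hτ.le
        push_cast
        linarith
      · intro y m hm
        beta_reduce at hm
        split_ifs at hm with h1 h2
        · exact (hlt y m hm).trans (Nat.lt_succ_self k)
        · simp at hm; omega
      · intro m hm
        rcases Nat.lt_succ_iff_lt_or_eq.1 hm with hm | rfl
        · rw [Function.update_of_ne hm.ne]
          refine le_trans (le_of_eq ?_) (herr m hm)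
          refine Finset.sum_congr (Finset.filter_congr fun y _ => ?_) fun _ _ => rfl
          beta_reduce
          split_ifs with h1 h2
          · rfl
          · push Not at h1
            simp [h1, hm.ne']
          · push Not at h1
            simp [h1]
        · rw [Function.update_self]
          have hsub : (Finset.univ.filter fun y =>
              (if g y ≠ none then g y else if τ ≤ W x y then some m else none) ≠ some m)
              ⊆ D ∪ Finset.univ.filter fun y => W x y < τ := by
            intro y
            simp only [hDdef, Finset.mem_filter, Finset.mem_univ, true_and, Finset.mem_union]
            split_ifs <;> simp_all
          calc _ ≤ ∑ y ∈ D ∪ Finset.univ.filter fun y => W x y < τ, W x y :=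
                Finset.sum_le_sum_of_subset_of_nonneg hsub fun y _ _ => hW.1 _ _
            _ ≤ ∑ y ∈ D, W x y + ∑ y with W x y < τ, W x y := by
                rw [← Finset.sum_union_inter]
                linarith [Finset.sum_nonneg fun y (_ : y ∈ D ∩ Finset.univ.filter
                  fun y => W x y < τ) => hW.1 x y]
            _ ≤ _ := by linarith [hε x]
  obtain ⟨f, g, -, hlt, herr⟩ := aux M le_rfl
  refine ⟨fun m => f m, fun y => (g y).pmap (fun m hm => ⟨m, hm⟩) fun m hm => hlt y m hm,
    fun m => ?_⟩
  refine le_trans (le_of_eq ?_) (herr m m.2)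
  refine Finset.sum_congr (Finset.filter_congr fun y _ => not_congr ?_) fun _ _ => rfl
  rw [Option.pmap_eq_some_iff]
  constructor
  · rintro ⟨a, h, ha, rfl⟩; exact ha
  · intro h; exact ⟨m, m.2, h, rfl⟩

/-! ### Tensor products of matrices -/

section Tensor

variable {K : ℕ} {H : Fin K → Type*}

theorem tensorMatrix_mul [∀ i, Fintype (H i)] (M N : ∀ i, Matrix (H i) (H i) ℂ) :
    tensorMatrix M * tensorMatrix N = tensorMatrix fun i => M i * N i := by
  ext s t
  simp only [tensorMatrix, Matrix.mul_apply, Matrix.of_apply, Fintype.prod_sum,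
    Finset.prod_mul_distrib]

theorem tensorMatrix_conjTranspose (M : ∀ i, Matrix (H i) (H i) ℂ) :
    (tensorMatrix M).conjTranspose = tensorMatrix fun i => (M i).conjTranspose := by
  ext s t
  simp [tensorMatrix, Matrix.conjTranspose_apply]

theorem tensorMatrix_one [∀ i, DecidableEq (H i)] :
    tensorMatrix (fun i => (1 : Matrix (H i) (H i) ℂ)) = 1 := by
  ext s t
  simp only [tensorMatrix, Matrix.of_apply, Matrix.one_apply]
  by_cases h : s = t
  · simp [h]
  · obtain ⟨i, hi⟩ := Function.ne_iff.1 h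
    rw [if_neg h, Finset.prod_eq_zero (Finset.mem_univ i) (if_neg hi)]

theorem tensorMatrix_sum {ι : Fin K → Type*} [∀ i, Fintype (ι i)]
    (M : ∀ i, ι i → Matrix (H i) (H i) ℂ) :
    tensorMatrix (fun i => ∑ b, M i b) = ∑ a : ∀ i, ι i, tensorMatrix fun i => M i (a i) := by
  ext s t
  simp only [tensorMatrix, Matrix.of_apply, Matrix.sum_apply, Fintype.prod_sum]

open scoped ComplexOrder MatrixOrder in
theorem posSemidef_tensorMatrix [∀ i, Fintype (H i)] [∀ i, DecidableEq (H i)]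
    {M : ∀ i, Matrix (H i) (H i) ℂ} (hM : ∀ i, (M i).PosSemidef) :
    (tensorMatrix M).PosSemidef := by
  choose B hB using fun i => CStarAlgebra.nonneg_iff_eq_star_mul_self.mp (hM i).nonneg
  have : tensorMatrix M = (tensorMatrix B).conjTranspose * tensorMatrix B := by
    rw [tensorMatrix_conjTranspose, tensorMatrix_mul]
    exact congrArg _ (funext hB)
  rw [this]
  exact Matrix.posSemidef_conjTranspose_mul_self _

end Tensor

/-! ### Parallel repetition of cooperations -/

section Power

variable {K : ℕ} {X Y : Fin K → Type*}

/-- Summing over `n`-tuples of tuples, arranged the other way round. -/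
theorem sum_prod_transpose {R : Type*} [CommSemiring R] [∀ i, Fintype (Y i)] {n : ℕ}
    (F : Fin n → (∀ i, Y i) → R) :
    ∑ y : ∀ i, Fin n → Y i, ∏ j, F j (fun i => y i j) = ∏ j, ∑ a, F j a := by
  rw [Fintype.prod_sum]
  exact (Equiv.piComm fun (i : Fin K) (_ : Fin n) => Y i).sum_comp
    fun y => ∏ j, F j (y j)

variable [∀ i, Fintype (Y i)]

theorem IsCondProb.channelPow {P : (∀ i, X i) → (∀ i, Y i) → ℝ} (hP : IsCondProb P) (n : ℕ) :
    IsCondProb (channelPow P n) := by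
  refine ⟨fun x y => Finset.prod_nonneg fun j _ => hP.1 _ _, fun x => ?_⟩
  simp only [GameIC.channelPow]
  rw [sum_prod_transpose fun j y => P (fun i => x i j) y]
  exact Finset.prod_eq_one fun j _ => hP.2 _

theorem marginal_channelPow (P : (∀ i, X i) → (∀ i, Y i) → ℝ) (n : ℕ) (i : Fin K)
    (x : ∀ i, Fin n → X i) (b : Fin n → Y i) :
    marginal (channelPow P n) i x b = ∏ j, marginal P i (fun k => x k j) (b j) := by
  classical
  unfold marginal
  rw [← sum_prod_transpose fun j a => if a i = b j then P (fun k => x k j) a else 0]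
  refine Finset.sum_congr rfl fun y _ => ?_
  by_cases h : y i = b
  · simp [h, channelPow]
  · obtain ⟨j, hj⟩ := Function.ne_iff.1 h
    rw [if_neg h, Finset.prod_eq_zero (Finset.mem_univ j) (if_neg hj)]

theorem IsNoSignaling.channelPow {P : (∀ i, X i) → (∀ i, Y i) → ℝ} (hP : IsNoSignaling P) (n : ℕ) :
    IsNoSignaling (channelPow P n) := by
  intro i x x' h b
  simp only [marginal_channelPow]
  exact Finset.prod_congr rfl fun j _ => hP i _ _ (congrFun h j) _

theorem IsPOVM.tensorMatrix {n : ℕ} {H β : Type*} [Fintype H] [DecidableEq H] [Fintype β]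
    {E : Fin n → β → Matrix H H ℂ} (hE : ∀ j, IsPOVM (E j)) :
    IsPOVM fun b : Fin n → β => tensorMatrix fun j => E j (b j) := by
  refine ⟨fun b => posSemidef_tensorMatrix fun j => (hE j).1 _, ?_⟩
  rw [← tensorMatrix_sum fun j b => E j b]
  simp only [(hE _).2, tensorMatrix_one]

open scoped ComplexOrder in
/-- The strategies on `n` copies of the shared state, one for each round, form a quantum strategy:
party `i` holds the tensor product of its `n` systems. -/
theorem IsQuantum.channelPow {P : (∀ i, X i) → (∀ i, Y i) → ℝ} (hP : IsQuantum P) (n : ℕ) :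
    IsQuantum (channelPow P n) := by
  obtain ⟨H, _, _, ρ, E, ⟨hρ, htr⟩, hE, hP⟩ := hP
  refine ⟨fun i => Fin n → H i, inferInstance, inferInstance,
    (tensorMatrix fun _ : Fin n => ρ).submatrix (fun s j i => s i j) (fun s j i => s i j),
    fun i x b => tensorMatrix fun j => E i (x j) (b j), ⟨?_, ?_⟩,
    fun i x => IsPOVM.tensorMatrix fun j => hE i (x j), ?_⟩
  · exact (posSemidef_tensorMatrix fun _ => hρ).submatrix _
  · simp only [Matrix.trace, Matrix.diag, tensorMatrix, Matrix.submatrix_apply, Matrix.of_apply]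
    rw [sum_prod_transpose fun _ s => ρ s s]
    exact Finset.prod_eq_one fun _ _ => htr
  · intro x a
    simp only [GameIC.channelPow, Complex.ofReal_prod, hP]
    simp only [Matrix.trace, Matrix.diag, Matrix.mul_apply, tensorMatrix, Matrix.submatrix_apply,
      Matrix.of_apply]
    rw [← sum_prod_transpose fun j s =>
      ∑ t, (∏ i, E i (x i j) (a i j) (s i) (t i)) * ρ t s]
    refine Finset.sum_congr rfl fun s _ => ?_
    rw [← sum_prod_transpose fun j t =>
      (∏ i, E i (x i j) (a i j) (s i j) (t i)) * ρ t fun i => s i j]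
    refine Finset.sum_congr rfl fun t _ => ?_
    rw [Finset.prod_mul_distrib, Finset.prod_comm]

end Power

/-! ### Local processing of cooperations -/

section Processing

variable {K : ℕ} {Q A M X : Fin K → Type*} [∀ i, Fintype (A i)]

open Classical in
/-- The cooperation in which party `i`, on input `m i`, asks `f i (m i)` of the cooperation `P` and
outputs the function `φ i (m i)` of the answer. -/
noncomputable def process (P : (∀ i, Q i) → (∀ i, A i) → ℝ) (f : ∀ i, M i → Q i)
    (φ : ∀ i, M i → A i → X i) (m : ∀ i, M i) (x : ∀ i, X i) : ℝ :=
  ∑ a, if (fun i => φ i (m i) (a i)) = x then P (fun i => f i (m i)) a else 0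

variable [∀ i, Fintype (X i)]

theorem sum_process_mul (P : (∀ i, Q i) → (∀ i, A i) → ℝ) (f : ∀ i, M i → Q i)
    (φ : ∀ i, M i → A i → X i) (m : ∀ i, M i) (F : (∀ i, X i) → ℝ) :
    ∑ x, process P f φ m x * F x
      = ∑ a, P (fun i => f i (m i)) a * F fun i => φ i (m i) (a i) := by
  classical
  simp only [process, Finset.sum_mul, ite_mul, zero_mul]
  rw [Finset.sum_comm]
  simp

theorem IsCondProb.process {P : (∀ i, Q i) → (∀ i, A i) → ℝ} (hP : IsCondProb P)
    (f : ∀ i, M i → Q i) (φ : ∀ i, M i → A i → X i) : IsCondProb (process P f φ) := by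
  classical
  refine ⟨fun m x => Finset.sum_nonneg fun a _ => ?_, fun m => ?_⟩
  · split_ifs
    exacts [hP.1 _ _, le_rfl]
  · have := sum_process_mul P f φ m fun _ => 1
    simpa [hP.2] using this

theorem IsNoSignaling.process {P : (∀ i, Q i) → (∀ i, A i) → ℝ} (hP : IsNoSignaling P)
    (f : ∀ i, M i → Q i) (φ : ∀ i, M i → A i → X i) : IsNoSignaling (process P f φ) := by
  classical
  have key : ∀ (i : Fin K) (m : ∀ i, M i) (b : X i), marginal (GameIC.process P f φ) i m b
      = ∑ a, if φ i (m i) a = b then marginal P i (fun k => f k (m k)) a else 0 := by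
    intro i m b
    have h1 := sum_process_mul P f φ m fun x => if x i = b then 1 else 0
    simp only [mul_ite, mul_one, mul_zero] at h1
    unfold marginal
    rw [h1]
    simp_rw [← Finset.sum_filter (p := fun a => φ i (m i) a = b)]
    rw [Finset.sum_comm]
    refine Finset.sum_congr rfl fun a _ => ?_
    simp
  intro i m m' h b
  rw [key, key, h]
  refine Finset.sum_congr rfl fun a _ => ?_
  rw [hP i (fun k => f k (m k)) (fun k => f k (m' k)) (by rw [h])]

open scoped ComplexOrder in
theorem IsQuantum.process {P : (∀ i, Q i) → (∀ i, A i) → ℝ} (hP : IsQuantum P)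
    (f : ∀ i, M i → Q i) (φ : ∀ i, M i → A i → X i) : IsQuantum (process P f φ) := by
  classical
  obtain ⟨H, _, _, ρ, E, hρ, hE, hP⟩ := hP
  refine ⟨H, inferInstance, inferInstance, ρ,
    fun i m x => ∑ a, if φ i m a = x then E i (f i m) a else 0, hρ, ?_, ?_⟩
  · refine fun i m => ⟨fun x => Matrix.posSemidef_sum _ fun a _ => ?_, ?_⟩
    · split_ifs
      exacts [(hE _ _).1 _, Matrix.PosSemidef.zero]
    · rw [Finset.sum_comm]
      simpa using (hE i (f i m)).2
  · intro m x
    rw [tensorMatrix_sum fun i a => if φ i (m i) a = x i then E i (f i (m i)) a else 0,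
      Finset.sum_mul, Matrix.trace_sum]
    simp only [GameIC.process, Complex.ofReal_sum]
    refine Finset.sum_congr rfl fun a _ => ?_
    split_ifs with h
    · rw [hP]
      subst h
      simp
    · obtain ⟨i, hi⟩ := Function.ne_iff.1 h
      have : tensorMatrix (fun i => if φ i (m i) (a i) = x i then E i (f i (m i)) (a i) else 0)
          = 0 := by
        ext s t
        simp only [tensorMatrix, Matrix.of_apply, Matrix.zero_apply]
        refine Finset.prod_eq_zero (Finset.mem_univ i) ?_
        rw [if_neg hi, Matrix.zero_apply]
      simp [this]

/-- Quantum and no-signaling cooperations remain so when used `n` times in parallel with local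
pre- and post-processing. -/
theorem process_channelPow_mem_cooperations {r : CoopType} (hr : r ≠ .classical)
    {P : (∀ i, Q i) → (∀ i, A i) → ℝ} (hP : P ∈ cooperations r Q A) {n : ℕ}
    (f : ∀ i, M i → Fin n → Q i) (φ : ∀ i, M i → (Fin n → A i) → X i) :
    process (channelPow P n) f φ ∈ cooperations r M X := by
  refine ⟨(hP.1.channelPow n).process f φ, ?_⟩
  match r, hP.2 with
  | .classical, _ => exact absurd rfl hr
  | .quantum, h => exact (IsQuantum.channelPow h n).process f φ
  | .noSignaling, h => exact (IsNoSignaling.channelPow h n).process f φ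

end Processing

/-! ### Achievability -/

theorem IsWeaklySymmetric.entropy_eq {α β : Type*} [Fintype α] [Fintype β] {V : α → β → ℝ}
    (hV : IsWeaklySymmetric V) (q q' : α) : entropy (V q') = entropy (V q) := by
  obtain ⟨σ, hσ⟩ := hV.2 q q'
  rw [← entropy_comp_equiv (V q) σ]
  exact congrArg entropy (funext hσ)

/-- The second moments of the self-informations of the rows of a finite channel are bounded. -/
theorem exists_secondMoment_le {α β : Type*} [Fintype α] [Fintype β] {V : α → β → ℝ}
    (hV : IsCondProb V) : ∃ B, ∀ x, ∑ y, V x y * Real.logb 2 (V x y) ^ 2 ≤ B :=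
  ⟨∑ x, ∑ y, V x y * Real.logb 2 (V x y) ^ 2, fun x =>
    Finset.single_le_sum (f := fun x => ∑ y, V x y * Real.logb 2 (V x y) ^ 2)
      (fun x _ => Finset.sum_nonneg fun y _ => mul_nonneg (hV.1 x y) (sq_nonneg _))
      (Finset.mem_univ x)⟩

theorem tendsto_chebyshev_bound (B δ : ℝ) :
    Filter.Tendsto (fun n : ℕ => B / (n * δ ^ 2)) Filter.atTop (nhds 0) := by
  have : (fun n : ℕ => B / (n * δ ^ 2)) = fun n : ℕ => B / δ ^ 2 * (n : ℝ)⁻¹ := by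
    funext n
    rw [div_eq_mul_inv, mul_inv, div_eq_mul_inv]
    ring
  rw [this]
  simpa using (tendsto_inv_atTop_nhds_zero_nat (𝕜 := ℝ)).const_mul (B / δ ^ 2)

theorem tendsto_two_rpow_neg_mul {δ : ℝ} (hδ : 0 < δ) :
    Filter.Tendsto (fun n : ℕ => (2 : ℝ) ^ (-(n * δ))) Filter.atTop (nhds 0) := by
  have : (fun n : ℕ => (2 : ℝ) ^ (-(n * δ))) = fun n : ℕ => ((2 : ℝ) ^ (-δ)) ^ n := by
    funext n
    rw [← Real.rpow_mul_natCast two_pos.le]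
    congr 1
    ring
  rw [this]
  exact tendsto_pow_atTop_nhds_zero_of_lt_one (by positivity)
    (Real.rpow_lt_one_of_one_lt_of_neg one_lt_two (by linarith))

theorem numMsg_le (n : ℕ) {R : ℝ} (hR : 0 ≤ R) : (numMsg n R : ℝ) ≤ 2 * (2 : ℝ) ^ (n * R) := by
  have h := (Nat.ceil_lt_add_one (a := (n : ℝ) * R) (by positivity)).le
  calc (numMsg n R : ℝ) = (2 : ℝ) ^ ((⌈(n : ℝ) * R⌉₊ : ℕ) : ℝ) := by
        rw [Real.rpow_natCast]; simp [numMsg]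
    _ ≤ (2 : ℝ) ^ ((n : ℝ) * R + 1) := Real.rpow_le_rpow_of_exponent_le one_le_two h
    _ = _ := by rw [Real.rpow_add two_pos, Real.rpow_one, mul_comm]

theorem le_numMsg (n : ℕ) (R : ℝ) : (2 : ℝ) ^ (n * R) ≤ numMsg n R := by
  calc (2 : ℝ) ^ ((n : ℝ) * R) ≤ (2 : ℝ) ^ ((⌈(n : ℝ) * R⌉₊ : ℕ) : ℝ) :=
        Real.rpow_le_rpow_of_exponent_le one_le_two (Nat.le_ceil _)
    _ = _ := by rw [Real.rpow_natCast]; simp [numMsg]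

theorem card_pow_eq_rpow {β : Type*} [Fintype β] [Nonempty β] (n : ℕ) :
    (Fintype.card β : ℝ) ^ n = (2 : ℝ) ^ (n * Real.logb 2 (Fintype.card β)) := by
  have hβ : (0 : ℝ) < Fintype.card β := by exact_mod_cast Fintype.card_pos
  rw [mul_comm, Real.rpow_mul_natCast two_pos.le, Real.rpow_logb two_pos (by norm_num) hβ]

open Classical in
/-- The direct part of the channel coding theorem for a weakly symmetric channel, with deterministic
codebooks and maximal error probability. -/
theorem IsWeaklySymmetric.exists_code {α β : Type*} [Fintype α] [Fintype β] [Nonempty α]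
    [Nonempty β] {V : α → β → ℝ} (hV : IsCondProb V) (hs : IsWeaklySymmetric V) {h R : ℝ}
    (hh : ∀ q, entropy (V q) = h)
    (hR : R = 0 ∨ 0 ≤ R ∧ R < Real.logb 2 (Fintype.card β) - h) :
    ∃ (f : ∀ n, Fin (numMsg n R) → Fin n → α)
      (g : ∀ n, (Fin n → β) → Option (Fin (numMsg n R))) (err : ℕ → ℝ),
      Filter.Tendsto err Filter.atTop (nhds 0) ∧
      ∀ n m, ∑ y with g n y ≠ some m, ∏ j, V (f n m j) (y j) ≤ err n := by
  rcases hR with rfl | ⟨hR0, hR⟩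
  · have h1 : ∀ n, numMsg n 0 = 1 := fun n => by simp [numMsg]
    refine ⟨fun n _ _ => Classical.arbitrary α, fun n _ => some ⟨0, by simp [h1]⟩, fun _ => 0,
      tendsto_const_nhds, fun n m => ?_⟩
    have hm : m = ⟨0, by simp [h1]⟩ := by
      ext
      have hlt := m.2
      have h1n := h1 n
      simp only
      omega
    rw [Finset.filter_false_of_mem fun y _ => by simp [hm], Finset.sum_empty]
  obtain ⟨δ, hδ, hδR⟩ : ∃ δ : ℝ, 0 < δ ∧ R + h + 2 * δ = Real.logb 2 (Fintype.card β) :=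
    ⟨(Real.logb 2 (Fintype.card β) - h - R) / 2, by linarith, by ring⟩
  obtain ⟨B, hB⟩ := exists_secondMoment_le hV
  obtain ⟨c, hc⟩ := hs.1
  have hcode : ∀ n : ℕ, ∃ (f : Fin (numMsg n R) → Fin n → α)
      (g : (Fin n → β) → Option (Fin (numMsg n R))), ∀ m,
      ∑ y with g y ≠ some m, ∏ j, V (f m j) (y j)
        ≤ B / (n * δ ^ 2) + 2 * (2 : ℝ) ^ (-(n * δ)) := by
    intro n
    have hτ : (0 : ℝ) < (2 : ℝ) ^ (-(n * (h + δ))) := by positivity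
    obtain ⟨f, g, hfg⟩ := exists_greedy_code
      (W := fun (x : Fin n → α) (y : Fin n → β) => ∏ j, V (x j) (y j))
      (IsCondProb.pi (V := fun _ : Fin n => V) fun _ => hV) (c := c ^ n)
      (fun y => by
        rw [← Fintype.prod_sum fun j x => V x (y j)]
        simp [hc]) hτ
      (fun x => sum_underlikely_le (p := fun j => V (x j)) (fun j => hV.1 _) (fun j => hV.2 _)
        (fun j => hB _) hδ fun j => (hh _).le) (numMsg n R)
    refine ⟨f, g, fun m => (hfg m).trans ?_⟩
    gcongr
    rw [div_le_iff₀ (by positivity)]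
    refine (numMsg_le n hR0).trans (le_of_eq ?_)
    rw [Fintype.card_fun, Fintype.card_fin, Nat.cast_pow, card_pow_eq_rpow, mul_assoc,
      ← Real.rpow_add two_pos, ← Real.rpow_add two_pos, ← hδR]
    congr 2
    ring
  choose f g hfg using hcode
  refine ⟨f, g, _, ?_, hfg⟩
  simpa using (tendsto_chebyshev_bound B δ).add ((tendsto_two_rpow_neg_mul hδ).const_mul 2)

section Channel

variable {K : ℕ}

theorem Code.errorProb_nonneg {X Y : Fin K → Type*} [∀ i, Fintype (X i)] [∀ i, Fintype (Y i)]
    {r : CoopType} {n : ℕ} {R : Fin K → ℝ} (c : Code X Y r n R)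
    {P : (∀ i, X i) → (∀ i, Y i) → ℝ} (hP : IsCondProb P) : 0 ≤ c.errorProb P := by
  refine Finset.sum_nonneg fun m _ => mul_nonneg (by positivity)
    (Finset.sum_nonneg fun x _ => mul_nonneg (c.enc_mem.1.1 _ _)
      (Finset.sum_nonneg fun y _ => mul_nonneg ((hP.channelPow n).1 _ _) ?_))
  split_ifs <;> norm_num

theorem sum_messages_inv (n : ℕ) (R : Fin K → ℝ) (a : ℝ) :
    ∑ _m : ∀ i, Fin (numMsg n (R i)), (∏ i, (numMsg n (R i) : ℝ))⁻¹ * a = a := by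
  have h : (∏ i, (numMsg n (R i) : ℝ)) ≠ 0 :=
    Finset.prod_ne_zero_iff.2 fun i _ => by simp [numMsg]
  simp only [Finset.sum_const, Finset.card_univ, Fintype.card_pi, Fintype.card_fin, nsmul_eq_mul,
    Nat.cast_prod]
  rw [← mul_assoc, mul_inv_cancel₀ h, one_mul]

variable {Q A Y : Fin K → Type*} [∀ i, Fintype (Q i)] [∀ i, Fintype (A i)] [∀ i, Fintype (Y i)]

/-- A strategy that wins with certainty gives no weight to losing answers. -/
theorem eq_zero_of_winProb_eq_one [Nonempty (∀ i, Q i)] {G : Game Q A}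
    {S : (∀ i, Q i) → (∀ i, A i) → ℝ} (hS : IsCondProb S) (hw : winProb G S = 1)
    {q : ∀ i, Q i} {a : ∀ i, A i} (hqa : (q, a) ∉ G.win) : S q a = 0 := by
  classical
  have hN : (0 : ℝ) < Fintype.card (∀ i, Q i) := by exact_mod_cast Fintype.card_pos
  have htot : ∑ q, ∑ a, S q a / (Fintype.card (∀ i, Q i) : ℝ) = 1 := by
    simp_rw [← Finset.sum_div, hS.2]
    rw [Finset.sum_const, Finset.card_univ, nsmul_eq_mul, mul_one,
      div_self hN.ne']
  have hlose : ∑ q, ∑ a, (if (q, a) ∈ G.win then 0 else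
      S q a / (Fintype.card (∀ i, Q i) : ℝ)) = 0 := by
    have hsplit : ∑ q, ∑ a, (if (q, a) ∈ G.win then 0 else
        S q a / (Fintype.card (∀ i, Q i) : ℝ)) + winProb G S
        = ∑ q, ∑ a, S q a / (Fintype.card (∀ i, Q i) : ℝ) := by
      unfold winProb
      simp_rw [← Finset.sum_add_distrib]
      refine Finset.sum_congr rfl fun q _ => Finset.sum_congr rfl fun a _ => ?_
      split_ifs <;> simp
    linarith
  have hnn : ∀ q a, 0 ≤ (if (q, a) ∈ G.win then 0 else
      S q a / (Fintype.card (∀ i, Q i) : ℝ)) := by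
    intro q a
    split_ifs
    exacts [le_rfl, div_nonneg (hS.1 _ _) hN.le]
  have h1 := (Finset.sum_eq_zero_iff_of_nonneg
    fun q _ => Finset.sum_nonneg fun a _ => hnn q a).1 hlose q (Finset.mem_univ _)
  have h2 := (Finset.sum_eq_zero_iff_of_nonneg fun a _ => hnn q a).1 h1 a (Finset.mem_univ _)
  rw [if_neg hqa, div_eq_zero_iff] at h2
  exact h2.resolve_right hN.ne'

open Classical in
/-- Union bound: over the parallel sub-channels, the probability that some receiver errs is at most
the sum of the individual error probabilities. -/
theorem sum_prod_mul_exists_le {Z : Fin K → Type*} [∀ i, Fintype (Z i)] {W : ∀ i, Z i → ℝ}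
    (h0 : ∀ i z, 0 ≤ W i z) (h1 : ∀ i, ∑ z, W i z = 1) (T : ∀ i, Z i → Prop) :
    ∑ z : ∀ i, Z i, (∏ i, W i (z i)) * (if ∃ i, T i (z i) then 1 else 0)
      ≤ ∑ i, ∑ z with T i z, W i z := by
  calc _ ≤ ∑ z : ∀ i, Z i, ∑ i, (∏ i, W i (z i)) * (if T i (z i) then 1 else 0) := by
        refine Finset.sum_le_sum fun z _ => ?_
        rw [← Finset.mul_sum]
        refine mul_le_mul_of_nonneg_left ?_ (Finset.prod_nonneg fun i _ => h0 i _)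
        have hnn : ∀ i ∈ (Finset.univ : Finset (Fin K)),
            (0 : ℝ) ≤ if T i (z i) then 1 else 0 := fun i _ => by split_ifs <;> norm_num
        split_ifs with h
        · obtain ⟨i, hi⟩ := h
          refine le_trans (by simp [hi]) (Finset.single_le_sum hnn (Finset.mem_univ i))
        · exact Finset.sum_nonneg hnn
    _ = _ := by
        rw [Finset.sum_comm]
        refine Finset.sum_congr rfl fun i _ => ?_
        rw [sum_prod_mul_eval h1 i fun z => if T i z then 1 else 0, Finset.sum_filter]
        simp

/-- Each transmitter encodes its message into questions by a codebook of its sub-channel, and the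
transmitters answer these questions by playing a perfect strategy in every channel use, which turns
the interference channel into the parallel sub-channels. -/
theorem IsGameChannel.isAchievable [∀ i, Nonempty (Q i)] [∀ i, Nonempty (Y i)] {r : CoopType}
    (hr : r ≠ .classical) {G : Game Q A} {P : (∀ i, Q i × A i) → (∀ i, Y i) → ℝ}
    {V : ∀ i, Q i → Y i → ℝ} (hP : IsGameChannel G P V) {S : (∀ i, Q i) → (∀ i, A i) → ℝ}
    (hS : S ∈ cooperations r Q A) (hw : winProb G S = 1) {h R : Fin K → ℝ}
    (hh : ∀ i q, entropy (V i q) = h i)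
    (hR : ∀ i, R i = 0 ∨ 0 ≤ R i ∧ R i < Real.logb 2 (Fintype.card (Y i)) - h i) :
    IsAchievable r P R := by
  classical
  choose f g err herr hfg using fun i =>
    (hP.weaklySymmetric i).exists_code (hP.condProb_sub i) (hh i) (hR i)
  refine ⟨fun i => (hR i).elim (fun h => h.ge) fun h => h.1, fun n =>
    { enc := process (channelPow S n) (fun i => f i n) fun i m a j => (f i n m j, a j)
      enc_mem := process_channelPow_mem_cooperations hr hS _ _
      dec := fun i => g i n }, ?_⟩
  have hlim : Filter.Tendsto (fun n => ∑ i, err i n) Filter.atTop (nhds 0) := by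
    simpa using tendsto_finsetSum Finset.univ fun i _ => herr i
  refine squeeze_zero (fun n => Code.errorProb_nonneg _ hP.condProb) (fun n => ?_) hlim
  unfold Code.errorProb
  rw [← sum_messages_inv n R (∑ i, err i n)]
  refine Finset.sum_le_sum fun m _ => mul_le_mul_of_nonneg_left ?_ (by positivity)
  rw [sum_process_mul]
  have hcond := hS.1.channelPow n
  have hone : ∑ i, err i n
      = ∑ a, channelPow S n (fun i => f i n (m i)) a * ∑ i, err i n := by
    rw [← Finset.sum_mul, hcond.2, one_mul]
  rw [hone]
  refine Finset.sum_le_sum fun a _ => ?_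
  by_cases hwin : ∀ j, ((fun i => f i n (m i) j), (fun i => a i j)) ∈ G.win
  · refine mul_le_mul_of_nonneg_left ?_ (hcond.1 _ _)
    have hpar : ∀ y : ∀ i, Fin n → Y i, channelPow P n (fun i j => (f i n (m i) j, a i j)) y
        = ∏ i, ∏ j, V i (f i n (m i) j) (y i j) := by
      intro y
      rw [Finset.prod_comm]
      exact Finset.prod_congr rfl fun j _ =>
        hP.parallel (fun i => (f i n (m i) j, a i j)) (hwin j) fun i => y i j
    have hcp := fun i => IsCondProb.pi (V := fun _ : Fin n => V i) fun _ => hP.condProb_sub i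
    have hunion := sum_prod_mul_exists_le (W := fun i y => ∏ j, V i (f i n (m i) j) (y j))
      (fun i y => (hcp i).1 (f i n (m i)) y) (fun i => (hcp i).2 (f i n (m i)))
      fun i y => g i n y ≠ some (m i)
    refine le_trans (le_of_eq (Finset.sum_congr rfl fun y _ => ?_))
      (hunion.trans (Finset.sum_le_sum fun i _ =>
        le_of_eq_of_le (by congr!) (hfg i n (m i))))
    rw [← hpar y]
    congr!
  · push Not at hwin
    obtain ⟨j, hj⟩ := hwin
    have hz : channelPow S n (fun i => f i n (m i)) a = 0 :=
      Finset.prod_eq_zero (Finset.mem_univ j) (eq_zero_of_winProb_eq_one hS.1 hw hj)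
    rw [hz, zero_mul, zero_mul]

end Channel

/-! ### Converse -/

section Converse

variable {K : ℕ} {X Y : Fin K → Type*} [∀ i, Fintype (X i)] [∀ i, Fintype (Y i)]

open Classical in
/-- A decoder succeeds only through outputs of probability above `τ`, or through the at most
`card` remaining outputs, each of which is decoded to a single message tuple and contributes at
most `τ`. -/
theorem Code.one_le_errorProb_add {r : CoopType} {n : ℕ} {R : Fin K → ℝ} (c : Code X Y r n R)
    {P : (∀ i, X i) → (∀ i, Y i) → ℝ} (hP : IsCondProb P) {τ e : ℝ} (hτ : 0 ≤ τ)
    (he : ∀ x, ∑ y with τ < channelPow P n x y, channelPow P n x y ≤ e) :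
    1 ≤ c.errorProb P
      + (e + τ * Fintype.card (∀ i, Fin n → Y i) / ∏ i, (numMsg n (R i) : ℝ)) := by
  set D : ℝ := ∏ i, (numMsg n (R i) : ℝ) with hD
  let ok : (∀ i, Fin (numMsg n (R i))) → (∀ i, Fin n → Y i) → ℝ :=
    fun m y => if ∃ i, c.dec i (y i) ≠ some (m i) then 0 else 1
  have hok1 : ∀ y, ∑ m, ok m y ≤ 1 := by
    intro y
    simp only [ok]
    rw [Finset.sum_ite, Finset.sum_const_zero, zero_add, Finset.sum_const, nsmul_eq_mul, mul_one]
    norm_cast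
    refine Finset.card_le_one.2 fun m hm m' hm' => ?_
    simp only [Finset.mem_filter, Finset.mem_univ, true_and, not_exists, not_not] at hm hm'
    funext i
    exact Option.some_injective _ ((hm i).symm.trans (hm' i))
  have hpow := hP.channelPow n
  have hrow : ∀ m x, 1 ≤ ∑ y, channelPow P n x y *
      (if ∃ i, c.dec i (y i) ≠ some (m i) then 1 else 0) + (e + τ * ∑ y, ok m y) := by
    intro m x
    have h1 := hpow.2 x
    have h2 := he x
    rw [Finset.sum_filter] at h2
    have h3 : ∑ y, channelPow P n x y ≤ ∑ y, (channelPow P n x y *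
        (if ∃ i, c.dec i (y i) ≠ some (m i) then 1 else 0)
        + (if τ < channelPow P n x y then channelPow P n x y else 0) + τ * ok m y) := by
      refine Finset.sum_le_sum fun y _ => ?_
      have h0 := hpow.1 x y
      simp only [ok]
      split_ifs <;> linarith
    rw [Finset.sum_add_distrib, Finset.sum_add_distrib, ← Finset.mul_sum] at h3
    linarith
  have hsum : ∑ m, ∑ y, ok m y ≤ Fintype.card (∀ i, Fin n → Y i) := by
    rw [Finset.sum_comm]
    simpa using Finset.sum_le_sum fun y (_ : y ∈ Finset.univ) => hok1 y
  have hD0 : 0 ≤ D := by positivity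
  calc (1 : ℝ) = ∑ _m : ∀ i, Fin (numMsg n (R i)), D⁻¹ * 1 := (sum_messages_inv n R 1).symm
    _ ≤ ∑ m, D⁻¹ * (∑ x, c.enc m x * ∑ y, channelPow P n x y *
          (if ∃ i, c.dec i (y i) ≠ some (m i) then 1 else 0) + (e + τ * ∑ y, ok m y)) := by
        refine Finset.sum_le_sum fun m _ => mul_le_mul_of_nonneg_left ?_ (inv_nonneg.2 hD0)
        have henc := c.enc_mem.1
        have h4 := Finset.sum_le_sum fun x (_ : x ∈ Finset.univ) =>
          mul_le_mul_of_nonneg_left (hrow m x) (henc.1 m x)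
        simp only [mul_add _ (∑ y, _) (e + _)] at h4
        rw [Finset.sum_add_distrib, ← Finset.sum_mul, ← Finset.sum_mul, henc.2, one_mul,
          one_mul] at h4
        exact h4
    _ = c.errorProb P + (e + τ * (∑ m, ∑ y, ok m y) / D) := by
        simp only [mul_add _ (∑ x, _) (e + _), mul_add _ e]
        rw [Finset.sum_add_distrib, Finset.sum_add_distrib, sum_messages_inv, Code.errorProb,
          div_eq_mul_inv]
        simp only [← Finset.mul_sum]
        ring
    _ ≤ _ := by gcongr

/-- The rates of reliable codes satisfy the capacity bound of the point-to-point channel between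
cooperating transmitters and cooperating receivers; the type of cooperation plays no role. -/
theorem IsAchievable.sum_le [∀ i, Nonempty (Y i)] {r : CoopType}
    {P : (∀ i, X i) → (∀ i, Y i) → ℝ} (hP : IsCondProb P) {H : ℝ} (hH : ∀ x, H ≤ entropy (P x))
    {R : Fin K → ℝ} (hR : IsAchievable r P R) :
    ∑ i, R i ≤ ∑ i, Real.logb 2 (Fintype.card (Y i)) - H := by
  classical
  by_contra! hlt
  obtain ⟨-, c, hc⟩ := hR
  set L := ∑ i, Real.logb 2 (Fintype.card (Y i)) with hL
  obtain ⟨δ, hδ, hδR⟩ : ∃ δ : ℝ, 0 < δ ∧ ∑ i, R i = L - H + 2 * δ :=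
    ⟨(∑ i, R i - (L - H)) / 2, by linarith, by ring⟩
  obtain ⟨B, hB⟩ := exists_secondMoment_le hP
  have hbound : ∀ n : ℕ, 1 ≤ (c n).errorProb P + (B / (n * δ ^ 2) + (2 : ℝ) ^ (-(n * δ))) := by
    intro n
    refine ((c n).one_le_errorProb_add hP (τ := (2 : ℝ) ^ (-(n * (H - δ)))) (by positivity)
      (e := B / (n * δ ^ 2)) fun x => ?_).trans ?_
    · refine le_trans (le_of_eq ?_) (sum_overlikely_le (p := fun j => P fun i => x i j)
        (fun j => hP.1 _) (fun j => hP.2 _) (fun j => hB _) hδ fun j => hH _)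
      rw [Finset.sum_filter, Finset.sum_filter]
      exact (Equiv.piComm fun (i : Fin K) (_ : Fin n) => Y i).sum_comp fun y =>
        if (2 : ℝ) ^ (-(n * (H - δ))) < ∏ j, P (fun i => x i j) (y j)
          then ∏ j, P (fun i => x i j) (y j) else 0
    · gcongr
      have hcard : (Fintype.card (∀ i, Fin n → Y i) : ℝ) = (2 : ℝ) ^ (n * L) := by
        rw [Fintype.card_pi, Nat.cast_prod, hL, Finset.mul_sum,
          Real.rpow_sum_of_pos two_pos]
        refine Finset.prod_congr rfl fun i _ => ?_
        rw [Fintype.card_fun, Fintype.card_fin, Nat.cast_pow, card_pow_eq_rpow]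
      have hmsg : (2 : ℝ) ^ (n * ∑ i, R i) ≤ ∏ i, (numMsg n (R i) : ℝ) := by
        rw [Finset.mul_sum, Real.rpow_sum_of_pos two_pos]
        exact Finset.prod_le_prod (fun i _ => by positivity) fun i _ => le_numMsg n (R i)
      have hpos : (0 : ℝ) < (2 : ℝ) ^ (n * ∑ i, R i) := by positivity
      rw [div_le_iff₀ (hpos.trans_le hmsg), hcard, ← Real.rpow_add two_pos]
      refine le_trans (le_of_eq ?_) (mul_le_mul_of_nonneg_left hmsg (by positivity))
      rw [← Real.rpow_add two_pos, hδR]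
      congr 1
      ring
  have hlim := hc.add ((tendsto_chebyshev_bound B δ).add (tendsto_two_rpow_neg_mul hδ))
  have := ge_of_tendsto' hlim hbound
  norm_num at this

end Converse

end GameIC

theorem proposition2 {K : ℕ} {Q A Y : Fin K → Type*}
    [∀ i, Fintype (Q i)] [∀ i, Fintype (A i)] [∀ i, Fintype (Y i)]
    (r : GameIC.CoopType) (G : GameIC.Game Q A) (hG : GameIC.IsPseudoTelepathy r G)
    (P : (∀ i, Q i × A i) → (∀ i, Y i) → ℝ) (V : ∀ i, Q i → Y i → ℝ)
    (hP : GameIC.IsGameChannel G P V) :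
    ∃ h : Fin K → ℝ, (∀ i q, GameIC.entropy (V i q) = h i) ∧
      GameIC.IsSumCapacity r P
        (∑ i, (Real.logb 2 (Fintype.card (Y i)) - h i)) := by
  classical
  obtain ⟨h1, p, hp1, hp⟩ := hG
  have hr : r ≠ .classical := by
    rintro rfl
    exact hp1.ne (hp.unique h1)
  obtain ⟨S, hS, hw⟩ := h1.1
  obtain ⟨q₀, a₀, hwin⟩ : ∃ q a, (q, a) ∈ G.win := by
    by_contra! hno
    simp [GameIC.winProb, hno] at hw
  have hQ : ∀ i, Nonempty (Q i) := fun i => ⟨q₀ i⟩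
  have hY : ∀ i, Nonempty (Y i) := by
    intro i
    by_contra hne
    rw [not_nonempty_iff] at hne
    simpa using (hP.condProb_sub i).2 (q₀ i)
  set h : Fin K → ℝ := fun i => GameIC.entropy (V i (q₀ i)) with hh_def
  have hh : ∀ i q, GameIC.entropy (V i q) = h i :=
    fun i q => (hP.weaklySymmetric i).entropy_eq (q₀ i) q
  have hwinH : ∀ x : ∀ i, Q i × A i, GameIC.splitInput x ∈ G.win →
      GameIC.entropy (P x) = ∑ i, h i := by
    intro x hx
    rw [show P x = fun y => ∏ i, V i (x i).1 (y i) from funext (hP.parallel x hx),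
      GameIC.entropy_prod (p := fun i => V i (x i).1) fun i => (hP.condProb_sub i).2 _]
    exact Finset.sum_congr rfl fun i _ => hh i _
  have hH : ∀ x, ∑ i, h i ≤ GameIC.entropy (P x) := by
    intro x
    by_cases hx : GameIC.splitInput x ∈ G.win
    · exact (hwinH x hx).ge
    · have hx₀ : GameIC.splitInput (fun i => (q₀ i, a₀ i)) ∈ G.win := hwin
      rw [← hwinH _ hx₀]
      exact (hP.less_noisy _ _ hx₀ hx).le
  refine ⟨h, hh, ⟨fun i => Real.logb 2 (Fintype.card (Y i)) - h i, ?_, rfl⟩, ?_⟩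
  · have hC : ∀ i, 0 ≤ Real.logb 2 (Fintype.card (Y i)) - h i := fun i =>
      sub_nonneg.2 (GameIC.entropy_le_logb_card ((hP.condProb_sub i).1 _)
        ((hP.condProb_sub i).2 _))
    -- rates approaching the capacities of the sub-channels; a sub-channel of capacity zero has to be
    -- given rate exactly zero
    refine mem_closure_of_tendsto (f := fun (k : ℕ) i =>
      max 0 (Real.logb 2 (Fintype.card (Y i)) - h i - ((k : ℝ) + 1)⁻¹)) (b := Filter.atTop) ?_
      (Filter.Eventually.of_forall fun k => ?_)
    · refine tendsto_pi_nhds.2 fun i => ?_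
      have hlim := (tendsto_const_nhds (x := (0 : ℝ))).max
        ((tendsto_one_div_add_atTop_nhds_zero_nat (𝕜 := ℝ)).const_sub
          (Real.logb 2 (Fintype.card (Y i)) - h i))
      rw [sub_zero, max_eq_right (hC i)] at hlim
      simpa using hlim
    · refine hP.isAchievable hr hS hw hh fun i => ?_
      rcases le_total (Real.logb 2 (Fintype.card (Y i)) - h i - ((k : ℝ) + 1)⁻¹) 0 with hle | hle
      · exact Or.inl (max_eq_left hle)
      · rw [max_eq_right hle]
        exact Or.inr ⟨hle, sub_lt_self _ (by positivity)⟩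
  · rintro _ ⟨R, hR, rfl⟩
    refine closure_minimal (t := {R : Fin K → ℝ |
      ∑ i, R i ≤ ∑ i, (Real.logb 2 (Fintype.card (Y i)) - h i)}) (fun R hR => ?_)
      (isClosed_le (by fun_prop) continuous_const) hR
    rw [Set.mem_ofPred_eq, Finset.sum_sub_distrib]
    exact GameIC.IsAchievable.sum_le hP.condProb hH hR
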